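/- A quantum query algorithm on graphs with vertex set $\{1,\dots,n\}$, in the adjacency matrix model, acts on a finite-dimensional space with computational basis $|i,j,b,w\rangle$ ($i,j$ vertices, $b\in\{0,1\}$, $w$ an arbitrary finite workspace). It starts in a basis state, applies arbitrary input-independent unitaries alternating with $T$ queries $|i,j,b,w\rangle\mapsto|i,j,b\oplus A_{i,j},w\rangle$, where $A$ is the adjacency matrix of the input graph $G$, then measures in the computational basis and outputs a function of the result. In the $k$-independent set problem the output is either a set of vertices or "none"; it is correct if it is an independent set of $G$ of size exactly $k$, or if it is "none" and $G$ has no independent set of size $k$. **Theorem.** The $k$-independent set problem requires $\Omega(n)$ quantum queries to the adjacency matrix. Precisely: for every error bound $0\le\varepsilon<1/2$ there is a constant $c>0$, depending only on $\varepsilon$, such that 1. for all integers $2\le k\le n$, every quantum query algorithm whose output is correct with probability at least $1-\varepsilon$ on every $n$-vertex graph makes at least $cn$ queries; 2. for all integers $k\ge 2$ and $n\ge 2k$ (in particular for every fixed $k\ge2$ and all sufficiently large $n$), even every quantum query algorithm that is only required to output an independent set of size $k$ with probability at least $1-\varepsilon$ on every $n$-vertex graph that has one (with no requirement on the other graphs)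 makes at least $cn$ queries. -/

import Mathlib

noncomputable section

namespace QuantumQuery

/-- Labels `(i, j, b, w)` of the computational basis: a query register holding a pair of vertices
`(i, j)`, an answer qubit `b`, and a workspace of dimension `d`. -/
abbrev Label (n d : ℕ) : Type := Fin n × Fin n × Bool × Fin d

/-- The Hilbert space spanned by the computational basis. -/
abbrev StateSpace (n d : ℕ) : Type := EuclideanSpace ℂ (Label n d)

open Classical in
/-- The entry `A i j` of the adjacency matrix of `G`, as a bit. -/
def adjBit {n : ℕ} (G : SimpleGraph (Fin n)) (i j : Fin n) : Bool := decide (G.Adj i j)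

/-- The permutation `(i, j, b, w) ↦ (i, j, b ⊕ A i j, w)` of the basis labels. -/
def oraclePerm {n d : ℕ} (G : SimpleGraph (Fin n)) : Equiv.Perm (Label n d) where
  toFun x := (x.1, x.2.1, xor x.2.2.1 (adjBit G x.1 x.2.1), x.2.2.2)
  invFun x := (x.1, x.2.1, xor x.2.2.1 (adjBit G x.1 x.2.1), x.2.2.2)
  left_inv x := by simp
  right_inv x := by simp

/-- One quantum query to the adjacency matrix of `G`: the unitary operator
`|i, j, b, w⟩ ↦ |i, j, b ⊕ A i j, w⟩`. -/
def oracle {n d : ℕ} (G : SimpleGraph (Fin n)) : StateSpace n d ≃ₗᵢ[ℂ] StateSpace n d :=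
  LinearIsometryEquiv.piLpCongrLeft 2 ℂ ℂ (oraclePerm G)

/-- A quantum query algorithm on `n`-vertex graphs with outputs in `α`: it starts in a basis state,
applies `unitary 0`, query, `unitary 1`, query, …, query, `unitary queries`
(arbitrary unitaries that do not depend on the input; those of larger index are never used),
measures in the computational basis, and outputs a function of the measured label. -/
structure Algorithm (n : ℕ) (α : Type) where
  /-- the dimension of the workspace -/
  dim : ℕ
  /-- the number of queries -/
  queries : ℕ
  /-- the label of the initial basis state -/
  start : Label n dim
  /-- the input-independent unitaries applied between the queries -/
  unitary : ℕ → (StateSpace n dim ≃ₗᵢ[ℂ] StateSpace n dim)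
  /-- the classical output read off from the measured label -/
  output : Label n dim → α

namespace Algorithm

variable {n : ℕ} {α : Type}

/-- The state on input `G` after `t` queries and the unitary that follows the last of them. -/
def state (A : Algorithm n α) (G : SimpleGraph (Fin n)) : ℕ → StateSpace n A.dim
  | 0 => A.unitary 0 (EuclideanSpace.single A.start 1)
  | t + 1 => A.unitary (t + 1) (oracle G (A.state G t))

open Classical in
/-- The probability that, on input `G`, the output of the algorithm satisfies `P`. -/
def prob (A : Algorithm n α) (G : SimpleGraph (Fin n)) (P : α → Prop) : ℝ :=
  ∑ x : Label n A.dim with P (A.output x), ‖A.state G A.queries x‖ ^ 2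

end Algorithm

/-- The correct answers to the `k`-independent set problem on `G`: an independent set of size `k`,
or the answer `none` if there is no such set. -/
def IsAnswer {n : ℕ} (k : ℕ) (G : SimpleGraph (Fin n)) : Option (Finset (Fin n)) → Prop
  | some S => G.IsNIndepSet k S
  | none => ∀ S : Finset (Fin n), ¬ G.IsNIndepSet k S

/-- On every graph, the answer is correct with probability at least `1 - ε`. -/
def Solves {n : ℕ} (k : ℕ) (ε : ℝ) (A : Algorithm n (Option (Finset (Fin n)))) : Prop :=
  ∀ G : SimpleGraph (Fin n), 1 - ε ≤ A.prob G (IsAnswer k G)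

/-- On every graph that has an independent set of size `k`, one is found with probability at least
`1 - ε`; nothing is required of the answers on other graphs. -/
def Finds {n : ℕ} (k : ℕ) (ε : ℝ) (A : Algorithm n (Option (Finset (Fin n)))) : Prop :=
  ∀ G : SimpleGraph (Fin n), (∃ S : Finset (Fin n), G.IsNIndepSet k S) →
    1 - ε ≤ A.prob G (IsAnswer k G)

end QuantumQuery

end

/-! Hybrid argument. Let `G e` differ from `H` only at the pair `e`. Each query spreads total weight
1 over all pairs, so after `T` queries the squared distances between the final states on `G e` and
`H` sum to at most `4 * T ^ 2` (`sum_norm_state_sub_state_sq_le`). If they are bounded below on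
average over at least `n ^ 2 / 16` pairs, then `T` is of order `n`. For `Solves`, `H` is a clique
with isolated vertices, sized so that changing any one of these pairs changes whether an independent
`k`-set exists. For `Finds`, `H` has no such set, and one created by deleting `e` determines `e`.
The run on `H` thus cannot succeed for many `e` at once. -/

namespace QuantumQuery

open Finset

/-! ### Effect of changing one pair on a single query -/

section Hybrid

variable {n d : ℕ}

theorem oracle_apply (G : SimpleGraph (Fin n)) (v : StateSpace n d) (x : Label n d) :
    oracle G v x = v (oraclePerm G x) := rfl

/-- The unordered pair of vertices in the query register. -/
def queryPair (x : Label n d) : Sym2 (Fin n) := s(x.1, x.2.1)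

theorem queryPair_oraclePerm (G : SimpleGraph (Fin n)) (x : Label n d) :
    queryPair (oraclePerm G x) = queryPair x := rfl

/-- The total squared amplitude of the labels that query the pair `e`. -/
noncomputable def queryWeight (e : Sym2 (Fin n)) (v : StateSpace n d) : ℝ :=
  ∑ x : Label n d with queryPair x = e, ‖v x‖ ^ 2

theorem sum_queryWeight_le (s : Finset (Sym2 (Fin n))) (v : StateSpace n d) :
    ∑ e ∈ s, queryWeight e v ≤ ‖v‖ ^ 2 := by
  classical
  rw [EuclideanSpace.norm_sq_eq, ← Finset.sum_fiberwise univ (queryPair (n := n) (d := d))]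
  exact Finset.sum_le_sum_of_subset_of_nonneg (subset_univ s)
    fun e _ _ => Finset.sum_nonneg fun x _ => by positivity

theorem queryWeight_oracle (G : SimpleGraph (Fin n)) (e : Sym2 (Fin n)) (v : StateSpace n d) :
    queryWeight e (oracle G v) = queryWeight e v := by
  simp only [queryWeight, oracle_apply, Finset.sum_filter]
  exact Equiv.sum_comp (oraclePerm G) fun x => if queryPair x = e then ‖v x‖ ^ 2 else 0

theorem norm_sub_sq_le_two_mul {E : Type*} [SeminormedAddCommGroup E] (a b : E) :
    ‖a - b‖ ^ 2 ≤ 2 * ‖a‖ ^ 2 + 2 * ‖b‖ ^ 2 := by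
  have h := norm_sub_le a b
  nlinarith [norm_nonneg (a - b), sq_nonneg (‖a‖ - ‖b‖)]

/-- Two oracles that differ only at the pair `e` act almost alike on states that rarely
query `e`. -/
theorem norm_oracle_sub_oracle_sq_le {G H : SimpleGraph (Fin n)} {e : Sym2 (Fin n)}
    (h : ∀ i j, s(i, j) ≠ e → (G.Adj i j ↔ H.Adj i j)) (v : StateSpace n d) :
    ‖oracle G v - oracle H v‖ ^ 2 ≤ 4 * queryWeight e v := by
  have hx : ∀ x : Label n d, ‖(oracle G v - oracle H v) x‖ ^ 2 ≤
      if queryPair x = e then 2 * ‖oracle G v x‖ ^ 2 + 2 * ‖oracle H v x‖ ^ 2 else 0 := by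
    intro x
    split_ifs with hxe
    · exact norm_sub_sq_le_two_mul _ _
    · have hp : oraclePerm G x = oraclePerm H x := by
        have hb : adjBit G x.1 x.2.1 = adjBit H x.1 x.2.1 := by
          rw [adjBit, adjBit, decide_eq_decide]
          exact h _ _ hxe
        simp only [oraclePerm, Equiv.coe_fn_mk, hb]
      simp [oracle_apply, hp]
  calc ‖oracle G v - oracle H v‖ ^ 2
      ≤ ∑ x : Label n d,
        if queryPair x = e then 2 * ‖oracle G v x‖ ^ 2 + 2 * ‖oracle H v x‖ ^ 2 else 0 := by
        rw [EuclideanSpace.norm_sq_eq]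
        exact Finset.sum_le_sum fun x _ => hx x
    _ = 2 * queryWeight e (oracle G v) + 2 * queryWeight e (oracle H v) := by
        rw [← Finset.sum_filter, Finset.sum_add_distrib, ← Finset.mul_sum, ← Finset.mul_sum]
        rfl
    _ = 4 * queryWeight e v := by
        rw [queryWeight_oracle, queryWeight_oracle]; ring

end Hybrid

/-! ### The hybrid argument and output probabilities -/

namespace Algorithm

variable {n : ℕ} {α : Type} (A : Algorithm n α)

theorem norm_state (G : SimpleGraph (Fin n)) (t : ℕ) : ‖A.state G t‖ = 1 := by
  induction t with
  | zero => simp [state]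
  | succ t ih => simp [state, ih]

/-- All errors are measured along the run on `H`, so one sequence of query weights serves for every
`G`. -/
theorem norm_state_sub_state_le (G H : SimpleGraph (Fin n)) (t : ℕ) :
    ‖A.state G t - A.state H t‖ ≤
      ∑ r ∈ range t, ‖oracle G (A.state H r) - oracle H (A.state H r)‖ := by
  induction t with
  | zero => simp [state]
  | succ t ih =>
    rw [Finset.sum_range_succ]
    calc ‖A.state G (t + 1) - A.state H (t + 1)‖
        = ‖oracle G (A.state G t) - oracle H (A.state H t)‖ := by
          simp only [state, ← map_sub, LinearIsometryEquiv.norm_map]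
      _ ≤ ‖oracle G (A.state G t) - oracle G (A.state H t)‖ +
            ‖oracle G (A.state H t) - oracle H (A.state H t)‖ := norm_sub_le_norm_sub_add_norm_sub ..
      _ ≤ _ := by
          rw [← map_sub, LinearIsometryEquiv.norm_map]
          gcongr

/-- The hybrid argument: if `G e` differs from `H` only at the pair `e`, then `t` queries
distinguish `H` poorly from an average `G e`. -/
theorem sum_norm_state_sub_state_sq_le (H : SimpleGraph (Fin n)) (s : Finset (Sym2 (Fin n)))
    (G : Sym2 (Fin n) → SimpleGraph (Fin n))
    (h : ∀ e ∈ s, ∀ i j, s(i, j) ≠ e → ((G e).Adj i j ↔ H.Adj i j)) (t : ℕ) :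
    ∑ e ∈ s, ‖A.state (G e) t - A.state H t‖ ^ 2 ≤ 4 * (t : ℝ) ^ 2 := by
  calc ∑ e ∈ s, ‖A.state (G e) t - A.state H t‖ ^ 2
      ≤ ∑ e ∈ s, t * ∑ r ∈ range t, 4 * queryWeight e (A.state H r) := by
        refine Finset.sum_le_sum fun e he => ?_
        calc ‖A.state (G e) t - A.state H t‖ ^ 2
            ≤ (∑ r ∈ range t, ‖oracle (G e) (A.state H r) - oracle H (A.state H r)‖) ^ 2 := by
              gcongr
              exact A.norm_state_sub_state_le (G e) H t
          _ ≤ t * ∑ r ∈ range t, ‖oracle (G e) (A.state H r) - oracle H (A.state H r)‖ ^ 2 := by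
              simpa using sq_sum_le_card_mul_sum_sq (s := range t)
                (f := fun r => ‖oracle (G e) (A.state H r) - oracle H (A.state H r)‖)
          _ ≤ _ := by
              gcongr with r _
              exact norm_oracle_sub_oracle_sq_le (h e he) _
    _ = t * ∑ r ∈ range t, 4 * ∑ e ∈ s, queryWeight e (A.state H r) := by
        rw [← Finset.mul_sum, Finset.sum_comm]
        simp only [Finset.mul_sum]
    _ ≤ t * ∑ r ∈ range t, 4 * (1 : ℝ) := by
        gcongr with r _
        simpa [A.norm_state H r] using sum_queryWeight_le s (A.state H r)
    _ = 4 * (t : ℝ) ^ 2 := by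
        simp; ring

theorem prob_mono (G : SimpleGraph (Fin n)) {P Q : α → Prop} (h : ∀ a, P a → Q a) :
    A.prob G P ≤ A.prob G Q := by
  classical
  refine Finset.sum_le_sum_of_subset_of_nonneg (fun x hx => ?_) fun x _ _ => by positivity
  simp only [mem_filter, mem_univ, true_and] at hx ⊢
  exact h _ hx

theorem prob_add_prob_not (G : SimpleGraph (Fin n)) (P : α → Prop) :
    A.prob G P + A.prob G (fun a => ¬ P a) = 1 := by
  classical
  have h := A.norm_state G A.queries
  have h2 : ‖A.state G A.queries‖ ^ 2 = 1 := by rw [h]; norm_num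
  rw [EuclideanSpace.norm_sq_eq] at h2
  rw [← h2, prob, prob]
  convert Finset.sum_filter_add_sum_filter_not univ (fun x => P (A.output x)) _

theorem sum_prob_le_one (G : SimpleGraph (Fin n)) {ι : Type*} (s : Finset ι) (P : ι → α → Prop)
    (hP : ∀ e ∈ s, ∀ f ∈ s, ∀ a, P e a → P f a → e = f) :
    ∑ e ∈ s, A.prob G (P e) ≤ 1 := by
  classical
  have h2 : ‖A.state G A.queries‖ ^ 2 = 1 := by rw [A.norm_state]; norm_num
  rw [EuclideanSpace.norm_sq_eq] at h2
  rw [← h2]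
  have hd : (s : Set ι).PairwiseDisjoint
      fun e => univ.filter fun x : Label n A.dim => P e (A.output x) := by
    intro e he f hf hef
    rw [Function.onFun, Finset.disjoint_left]
    intro x hx hx'
    simp only [mem_filter, mem_univ, true_and] at hx hx'
    exact hef (hP e he f hf _ hx hx')
  calc ∑ e ∈ s, A.prob G (P e)
      = ∑ x ∈ s.biUnion fun e => univ.filter fun x : Label n A.dim => P e (A.output x),
          ‖A.state G A.queries x‖ ^ 2 := by
        rw [Finset.sum_biUnion hd]
        refine Finset.sum_congr rfl fun e _ => ?_
        rw [prob]
    _ ≤ _ := Finset.sum_le_sum_of_subset_of_nonneg (subset_univ _) fun x _ _ => by positivity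

theorem prob_le_add_norm_sq (G H : SimpleGraph (Fin n)) (P : α → Prop) {u : ℝ} (hu : 0 < u) :
    A.prob G P ≤ (1 + u) * A.prob H P +
      (1 + 1 / u) * ‖A.state G A.queries - A.state H A.queries‖ ^ 2 := by
  classical
  set v := A.state G A.queries with hv
  set w := A.state H A.queries with hw
  have key : ∀ x, ‖v x‖ ^ 2 ≤ (1 + u) * ‖w x‖ ^ 2 + (1 + 1 / u) * ‖(v - w) x‖ ^ 2 := by
    intro x
    have h : ‖v x‖ ≤ ‖w x‖ + ‖(v - w) x‖ := by
      simpa using norm_add_le (w x) ((v - w) x)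
    have h1 : ‖v x‖ ^ 2 ≤ (‖w x‖ + ‖(v - w) x‖) ^ 2 := by gcongr
    -- Weighted AM-GM for the cross term in the square of the sum.
    have h2 : 0 ≤ (u * ‖w x‖ - ‖(v - w) x‖) ^ 2 / u := by positivity
    have h3 : (u * ‖w x‖ - ‖(v - w) x‖) ^ 2 / u =
        (1 + u) * ‖w x‖ ^ 2 + (1 + 1 / u) * ‖(v - w) x‖ ^ 2 - (‖w x‖ + ‖(v - w) x‖) ^ 2 := by
      field_simp; ring
    linarith
  rw [EuclideanSpace.norm_sq_eq, prob, prob, ← hv, ← hw]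
  refine (Finset.sum_le_sum fun x _ => key x).trans ?_
  rw [Finset.sum_add_distrib, ← Finset.mul_sum, ← Finset.mul_sum]
  gcongr
  exact subset_univ _

/-- If some event has probability at most `ε` on one of `G`, `H` and at least `1 - ε` on the
other, then the final states are far apart. -/
theorem norm_sq_ge_of_distinguishes {G H : SimpleGraph (Fin n)} {P : α → Prop} {ε : ℝ}
    (hε' : ε < 1 / 2) (hG : 1 - ε ≤ A.prob G P) (hH : A.prob H P ≤ ε) :
    (1 - 2 * ε) ^ 2 / 2 ≤ ‖A.state G A.queries - A.state H A.queries‖ ^ 2 := by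
  have hu : 0 < 1 - 2 * ε := by linarith
  -- With `u = 1 - 2 * ε` both sides acquire a factor `1 - ε`, cancelled in `h4`.
  have h := A.prob_le_add_norm_sq G H P hu
  set D := ‖A.state G A.queries - A.state H A.queries‖ ^ 2
  have h1 : 1 - ε ≤ (1 + (1 - 2 * ε)) * ε + (1 + 1 / (1 - 2 * ε)) * D := by
    have : (1 + (1 - 2 * ε)) * A.prob H P ≤ (1 + (1 - 2 * ε)) * ε := by gcongr
    linarith
  have h2 : (1 - ε) * (1 - 2 * ε) ≤ (1 + 1 / (1 - 2 * ε)) * D := by linarith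
  have h3 : (1 + 1 / (1 - 2 * ε)) * D = (1 - ε) * (2 * D / (1 - 2 * ε)) := by
    field_simp; ring
  rw [h3] at h2
  have h4 := le_of_mul_le_mul_left h2 (by linarith)
  rw [le_div_iff₀ hu] at h4
  linarith

end Algorithm

/-! ### Cliques with isolated vertices, and one-pair changes -/

section Graphs

variable {n k : ℕ}

/-- The graph in which the vertices of `C` form a clique and all others are isolated. -/
def cliqueOn (C : Finset (Fin n)) : SimpleGraph (Fin n) where
  Adj i j := i ≠ j ∧ i ∈ C ∧ j ∈ C
  symm := ⟨fun _ _ h => ⟨h.1.symm, h.2.2, h.2.1⟩⟩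
  loopless := ⟨fun _ h => h.1 rfl⟩

/-- The unordered pairs of distinct elements of `C`. -/
def pairsIn (C : Finset (Fin n)) : Finset (Sym2 (Fin n)) := C.offDiag.image Sym2.mk.uncurry

theorem exists_of_mem_pairsIn {C : Finset (Fin n)} {e : Sym2 (Fin n)} (he : e ∈ pairsIn C) :
    ∃ a ∈ C, ∃ b ∈ C, a ≠ b ∧ e = s(a, b) := by
  simp only [pairsIn, mem_image, mem_offDiag, Prod.exists] at he
  obtain ⟨a, b, ⟨ha, hb, hab⟩, rfl⟩ := he
  exact ⟨a, ha, b, hb, hab, rfl⟩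

theorem sq_le_card_pairsIn {C : Finset (Fin n)} (hC : 2 ≤ C.card) (h : n ≤ 2 * C.card) :
    (n : ℝ) ^ 2 / 16 ≤ (pairsIn C).card := by
  have h1 : (pairsIn C).card = C.card.choose 2 := Sym2.card_image_offDiag C
  rw [h1, Nat.cast_choose_two]
  have h2 : (2 : ℝ) ≤ C.card := by exact_mod_cast hC
  have h3 : (n : ℝ) ≤ 2 * C.card := by exact_mod_cast h
  nlinarith [(Nat.cast_nonneg n : (0 : ℝ) ≤ n)]

theorem exists_card_eq_of_le {m : ℕ} (h : m ≤ n) : ∃ C : Finset (Fin n), C.card = m := by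
  obtain ⟨C, -, hC⟩ := Finset.exists_subset_card_eq (s := (univ : Finset (Fin n))) (by simpa using h)
  exact ⟨C, hC⟩

theorem card_compl_fin (C : Finset (Fin n)) : Cᶜ.card + C.card = n := by
  simpa only [Fintype.card_fin] using Finset.card_compl_add_card C

theorem card_inter_le_one {G : SimpleGraph (Fin n)} {C S : Finset (Fin n)}
    (hG : cliqueOn C ≤ G) (hS : G.IsIndepSet S) : (S ∩ C).card ≤ 1 := by
  rw [Finset.card_le_one]
  intro a ha b hb
  rw [mem_inter] at ha hb
  by_contra hab
  exact hS (by simpa using ha.1) (by simpa using hb.1) hab (hG ⟨hab, ha.2, hb.2⟩)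

theorem not_isNIndepSet_cliqueOn {C : Finset (Fin n)} (hC : C.card + k = n + 2)
    (S : Finset (Fin n)) : ¬ (cliqueOn C).IsNIndepSet k S := by
  intro hS
  have h1 := card_inter_le_one le_rfl hS.isIndepSet
  have h2 := Finset.card_le_card (show S ⊆ (S ∩ C) ∪ Cᶜ by intro x; simp; tauto)
  have h3 := Finset.card_union_le (S ∩ C) Cᶜ
  have h4 := card_compl_fin C
  have h5 := hS.card_eq
  omega

theorem isNIndepSet_cliqueOn_deleteEdges {C : Finset (Fin n)} (hC : C.card + k = n + 2)
    {e : Sym2 (Fin n)} (he : e ∈ pairsIn C) :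
    ∃ S, ((cliqueOn C).deleteEdges {e}).IsNIndepSet k S := by
  obtain ⟨a, ha, b, hb, hab, rfl⟩ := exists_of_mem_pairsIn he
  refine ⟨{a, b} ∪ Cᶜ, ⟨?_, ?_⟩⟩
  · intro x hx y hy hxy h
    simp only [SimpleGraph.deleteEdges_adj, cliqueOn, Set.mem_singleton_iff] at h
    simp only [coe_union, coe_insert, coe_singleton, coe_compl, Set.mem_union, Set.mem_insert_iff,
      Set.mem_singleton_iff, Set.mem_compl_iff, mem_coe] at hx hy
    have hx' : x = a ∨ x = b := hx.resolve_right fun h' => h' h.1.2.1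
    have hy' : y = a ∨ y = b := hy.resolve_right fun h' => h' h.1.2.2
    apply h.2
    rcases hx' with rfl | rfl <;> rcases hy' with rfl | rfl <;> simp_all [Sym2.eq_swap]
  · have hd : Disjoint ({a, b} : Finset (Fin n)) Cᶜ := by
      simp [ha, hb]
    rw [Finset.card_union_of_disjoint hd, Finset.card_pair hab]
    have := card_compl_fin C
    omega

/-- Only `k - 2` vertices lie outside `C`, so `S` has two vertices in `C`, and these must be the
ends of the deleted edge. -/
theorem eq_of_isNIndepSet_cliqueOn_deleteEdges {C : Finset (Fin n)} (hC : C.card + k = n + 2)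
    {e f : Sym2 (Fin n)} {S : Finset (Fin n)}
    (he : ((cliqueOn C).deleteEdges {e}).IsNIndepSet k S)
    (hf : ((cliqueOn C).deleteEdges {f}).IsNIndepSet k S) : e = f := by
  have h2 := Finset.card_le_card (show S ⊆ (S ∩ C) ∪ Cᶜ by intro x; simp; tauto)
  have h3 := Finset.card_union_le (S ∩ C) Cᶜ
  have h4 := card_compl_fin C
  have h5 := he.card_eq
  obtain ⟨a, ha, b, hb, hab⟩ := Finset.one_lt_card.1 (show 1 < (S ∩ C).card by omega)
  rw [mem_inter] at ha hb
  have key : ∀ g, ((cliqueOn C).deleteEdges {g}).IsNIndepSet k S → s(a, b) = g := by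
    intro g hg
    by_contra hne
    exact hg.isIndepSet (by simpa using ha.1) (by simpa using hb.1) hab
      (by simpa [SimpleGraph.deleteEdges_adj, hne] using ⟨hab, ha.2, hb.2⟩)
  rw [← key e he, key f hf]

theorem isNIndepSet_cliqueOn {C : Finset (Fin n)} (hC : C.card + k = n + 1) (hk : k ≤ n) :
    ∃ S, (cliqueOn C).IsNIndepSet k S := by
  obtain ⟨c, hc⟩ := Finset.card_pos.1 (show 0 < C.card by omega)
  refine ⟨insert c Cᶜ, ⟨?_, ?_⟩⟩
  · intro x hx y hy hxy h
    simp only [coe_insert, coe_compl, Set.mem_insert_iff, Set.mem_compl_iff, mem_coe] at hx hy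
    exact hxy ((hx.resolve_right fun h' => h' h.2.1).trans
      (hy.resolve_right fun h' => h' h.2.2).symm)
  · rw [Finset.card_insert_of_notMem (by simpa using hc)]
    have := card_compl_fin C
    omega

/-- An independent `k`-set would need one vertex of `C` and all `k - 1` vertices of `Cᶜ`, but `e`
joins two of the latter. -/
theorem not_isNIndepSet_cliqueOn_sup {C : Finset (Fin n)} (hC : C.card + k = n + 1)
    {e : Sym2 (Fin n)} (he : e ∈ pairsIn Cᶜ) (S : Finset (Fin n)) :
    ¬ (cliqueOn C ⊔ SimpleGraph.fromEdgeSet {e}).IsNIndepSet k S := by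
  intro hS
  obtain ⟨a, ha, b, hb, hab, rfl⟩ := exists_of_mem_pairsIn he
  have h1 := card_inter_le_one le_sup_left hS.isIndepSet
  have h2 := Finset.card_le_card (show S ⊆ (S ∩ C) ∪ (S ∩ Cᶜ) by intro x; simp; tauto)
  have h3 := Finset.card_union_le (S ∩ C) (S ∩ Cᶜ)
  have h4 := card_compl_fin C
  have h5 := hS.card_eq
  have h6 : (S ∩ Cᶜ).card < Cᶜ.card := by
    refine Finset.card_lt_card ((Finset.ssubset_iff_of_subset inter_subset_right).2 ?_)
    by_contra! hall
    exact hS.isIndepSet (by simpa using (mem_inter.1 (hall a ha)).1)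
      (by simpa using (mem_inter.1 (hall b hb)).1) hab (Or.inr (by simpa using hab))
  omega

theorem deleteEdges_singleton_adj_iff (G : SimpleGraph (Fin n)) {e : Sym2 (Fin n)} {i j : Fin n}
    (h : s(i, j) ≠ e) : (G.deleteEdges {e}).Adj i j ↔ G.Adj i j := by
  simp [SimpleGraph.deleteEdges_adj, h]

theorem sup_fromEdgeSet_singleton_adj_iff (G : SimpleGraph (Fin n)) {e : Sym2 (Fin n)}
    {i j : Fin n} (h : s(i, j) ≠ e) :
    (G ⊔ SimpleGraph.fromEdgeSet {e}).Adj i j ↔ G.Adj i j := by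
  simp [h]

end Graphs

/-! ### Counting pairs to bound the queries -/

section LowerBounds

variable {n k : ℕ} {ε : ℝ} {A : Algorithm n (Option (Finset (Fin n)))}

theorem prob_none_ge {G : SimpleGraph (Fin n)} (hA : 1 - ε ≤ A.prob G (IsAnswer k G))
    (hG : ∀ S, ¬ G.IsNIndepSet k S) : 1 - ε ≤ A.prob G (· = none) := by
  refine hA.trans (A.prob_mono G ?_)
  rintro (_ | S) h
  · rfl
  · exact absurd h (hG S)

theorem prob_none_le {G : SimpleGraph (Fin n)} (hA : 1 - ε ≤ A.prob G (IsAnswer k G))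
    (hG : ∃ S, G.IsNIndepSet k S) : A.prob G (· = none) ≤ ε := by
  have h1 := A.prob_add_prob_not G (· = none)
  have h2 : A.prob G (IsAnswer k G) ≤ A.prob G (fun a => ¬ a = none) := by
    refine A.prob_mono G ?_
    rintro (_ | S) h
    · exact absurd hG (by simpa [IsAnswer] using h)
    · simp
  linarith

theorem mul_le_of_card_mul_sq_le {s : Finset (Sym2 (Fin n))} {T : ℕ} {c γ : ℝ}
    (hγ : 64 * c ^ 2 ≤ γ) (hs : (n : ℝ) ^ 2 / 16 ≤ s.card) (h : s.card * γ ≤ 4 * (T : ℝ) ^ 2) :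
    c * n ≤ T := by
  refine le_of_sq_le_sq ?_ (Nat.cast_nonneg T)
  have h1 : (n : ℝ) ^ 2 / 16 * (64 * c ^ 2) ≤ s.card * γ := by gcongr
  nlinarith

theorem le_queries_of_solves (hε' : ε < 1 / 2) (hk2 : 2 ≤ k) (hk : k ≤ n)
    (hA : Solves k ε A) : (1 - 2 * ε) / 28 * n ≤ A.queries := by
  have hγ : 64 * ((1 - 2 * ε) / 28) ^ 2 ≤ (1 - 2 * ε) ^ 2 / 2 := by
    nlinarith [sq_nonneg (1 - 2 * ε)]
  -- Either the clique or its complement has at least half the vertices; pairs are changed on the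
  -- large side.
  rcases le_or_gt n (2 * (n + 2 - k)) with h | h
  · obtain ⟨C, hC⟩ := exists_card_eq_of_le (n := n) (m := n + 2 - k) (by omega)
    have hC' : C.card + k = n + 2 := by omega
    refine mul_le_of_card_mul_sq_le hγ
      (sq_le_card_pairsIn (C := C) (by omega) (by omega)) ?_
    refine le_trans ?_ (A.sum_norm_state_sub_state_sq_le (cliqueOn C) (pairsIn C)
      (fun e => (cliqueOn C).deleteEdges {e})
      (fun e _ i j h => deleteEdges_singleton_adj_iff _ h) A.queries)
    rw [← nsmul_eq_mul]
    refine Finset.card_nsmul_le_sum _ _ _ fun e he => ?_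
    rw [norm_sub_rev]
    exact A.norm_sq_ge_of_distinguishes hε'
      (prob_none_ge (hA _) (not_isNIndepSet_cliqueOn hC'))
      (prob_none_le (hA _) (isNIndepSet_cliqueOn_deleteEdges hC' he))
  · obtain ⟨C, hC⟩ := exists_card_eq_of_le (n := n) (m := n + 1 - k) (by omega)
    have hC' : C.card + k = n + 1 := by omega
    have hCc := card_compl_fin C
    refine mul_le_of_card_mul_sq_le hγ
      (sq_le_card_pairsIn (C := Cᶜ) (by omega) (by omega)) ?_
    refine le_trans ?_ (A.sum_norm_state_sub_state_sq_le (cliqueOn C) (pairsIn Cᶜ)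
      (fun e => cliqueOn C ⊔ SimpleGraph.fromEdgeSet {e})
      (fun e _ i j h => sup_fromEdgeSet_singleton_adj_iff _ h) A.queries)
    rw [← nsmul_eq_mul]
    refine Finset.card_nsmul_le_sum _ _ _ fun e he => ?_
    exact A.norm_sq_ge_of_distinguishes hε'
      (prob_none_ge (hA _) (not_isNIndepSet_cliqueOn_sup hC' he))
      (prob_none_le (hA _) (isNIndepSet_cliqueOn hC' hk))

theorem le_queries_of_finds (hε' : ε < 1 / 2) (hk2 : 2 ≤ k) (hk : 2 * k ≤ n)
    (hA : Finds k ε A) : 1 / 28 * (n : ℝ) ≤ A.queries := by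
  obtain ⟨C, hC⟩ := exists_card_eq_of_le (n := n) (m := n + 2 - k) (by omega)
  have hC' : C.card + k = n + 2 := by omega
  -- With `M` pairs, `M / 2 ≤ 2 + 2 * D` for the summed squared distances `D`, so `D ≥ M / 4 - 1 ≥ M
  -- / 12` once `M ≥ 6`. The constant 28 works since `64 / 28 ^ 2 = 4 / 49 ≤ 1 / 12`.
  refine mul_le_of_card_mul_sq_le (γ := 1 / 12) (by norm_num)
    (sq_le_card_pairsIn (C := C) (by omega) (by omega)) ?_
  refine le_trans ?_ (A.sum_norm_state_sub_state_sq_le (cliqueOn C) (pairsIn C)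
    (fun e => (cliqueOn C).deleteEdges {e})
    (fun e _ i j h => deleteEdges_singleton_adj_iff _ h) A.queries)
  have hM : (6 : ℝ) ≤ (pairsIn C).card := by
    have h1 : (pairsIn C).card = C.card.choose 2 := Sym2.card_image_offDiag C
    rw [h1]
    exact_mod_cast (Nat.choose_le_choose 2 (show 4 ≤ C.card by omega) : Nat.choose 4 2 ≤ _)
  have hsum : ∑ e ∈ pairsIn C, A.prob (cliqueOn C) (IsAnswer k ((cliqueOn C).deleteEdges {e})) ≤ 1 := by
    refine A.sum_prob_le_one _ _ _ fun e he f _ a hea hfa => ?_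
    cases a with
    | none =>
      obtain ⟨S, hS⟩ := isNIndepSet_cliqueOn_deleteEdges hC' he
      exact absurd hS (hea S)
    | some S => exact eq_of_isNIndepSet_cliqueOn_deleteEdges hC' hea hfa
  have hle : ∑ e ∈ pairsIn C, (1 / 2 : ℝ) ≤ ∑ e ∈ pairsIn C,
      (2 * A.prob (cliqueOn C) (IsAnswer k ((cliqueOn C).deleteEdges {e})) +
        2 * ‖A.state ((cliqueOn C).deleteEdges {e}) A.queries -
          A.state (cliqueOn C) A.queries‖ ^ 2) := by
    refine Finset.sum_le_sum fun e he => ?_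
    have h1 := hA _ (isNIndepSet_cliqueOn_deleteEdges hC' he)
    have h2 := A.prob_le_add_norm_sq ((cliqueOn C).deleteEdges {e}) (cliqueOn C)
      (IsAnswer k ((cliqueOn C).deleteEdges {e})) one_pos
    norm_num at h2
    linarith
  rw [Finset.sum_add_distrib, ← Finset.mul_sum, ← Finset.mul_sum, Finset.sum_const,
    nsmul_eq_mul] at hle
  linarith

end LowerBounds

end QuantumQuery

theorem mainTheorem10 (ε : ℝ) (hε : 0 ≤ ε) (hε' : ε < 1 / 2) :
    ∃ c : ℝ, 0 < c ∧
      (∀ n k : ℕ, 2 ≤ k → k ≤ n →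
        ∀ A : QuantumQuery.Algorithm n (Option (Finset (Fin n))),
          QuantumQuery.Solves k ε A → c * (n : ℝ) ≤ (A.queries : ℝ)) ∧
      (∀ n k : ℕ, 2 ≤ k → 2 * k ≤ n →
        ∀ A : QuantumQuery.Algorithm n (Option (Finset (Fin n))),
          QuantumQuery.Finds k ε A → c * (n : ℝ) ≤ (A.queries : ℝ)) := by
  refine ⟨(1 - 2 * ε) / 28, by linarith, fun n k hk2 hk A hA => ?_, fun n k hk2 hk A hA => ?_⟩
  · exact QuantumQuery.le_queries_of_solves hε' hk2 hk hA
  · refine le_trans ?_ (QuantumQuery.le_queries_of_finds hε' hk2 hk hA)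
    gcongr
    linarith
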